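/- Let $n\ge 1$, and let $\mathcal A_{A_n}$ be the Artin group of type $A_n$, that is, the group generated by $a_1,\dots,a_n$ with defining relations $a_ia_{i+1}a_i=a_{i+1}a_ia_{i+1}$ for $1\le i\le n-1$ and $a_ia_j=a_ja_i$ for $|i-j|\ge 2$ (it is isomorphic to the braid group on $n+1$ strings). A group $G$ is called locally indicable if for every nontrivial finitely generated subgroup $H$ of $G$ there is a nontrivial homomorphism $H\to\mathbb Z$. Then $\mathcal A_{A_n}$ is locally indicable if and only if $n=1$, $2$ or $3$. -/

import Mathlib

/-- The alternating product `a * b * a * ⋯` with `q` factors, starting with `a`. -/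
def altProd {G : Type*} [Monoid G] : G → G → ℕ → G
  | _, _, 0 => 1
  | a, b, q + 1 => a * altProd b a q

/-- The relators `⟨ab⟩^m * (⟨ba⟩^m)⁻¹`, where `m = M a b < ∞`, in the free group on the index set of
a Coxeter matrix `M`. (In Mathlib's Coxeter matrices the entry `∞` is encoded by `0`.) -/
def CoxeterMatrix.artinRelators {S : Type*} (M : CoxeterMatrix S) : Set (FreeGroup S) :=
  {r | ∃ a b : S, M a b ≠ 0 ∧
    r = altProd (FreeGroup.of a) (FreeGroup.of b) (M a b) *
      (altProd (FreeGroup.of b) (FreeGroup.of a) (M a b))⁻¹}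

/-- The Artin group of a Coxeter matrix `M` over `S`, given by the presentation
`⟨a ∈ S : ⟨ab⟩^(M a b) = ⟨ba⟩^(M a b) if M a b < ∞⟩`. -/
abbrev CoxeterMatrix.ArtinGroup {S : Type*} (M : CoxeterMatrix S) : Type _ :=
  PresentedGroup M.artinRelators

/-- A group is indicable if it admits a nontrivial homomorphism to the infinite cyclic group. -/
def IsIndicable (G : Type*) [Group G] : Prop :=
  ∃ f : G →* Multiplicative ℤ, f ≠ 1

/-- A group is locally indicable if each of its nontrivial finitely generated subgroups is
indicable. -/
def IsLocallyIndicable (G : Type*) [Group G] : Prop :=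
  ∀ H : Subgroup G, H.FG → H ≠ ⊥ → IsIndicable H

/-!
Write `a, b, c, d` for the first four standard generators.

*Few generators.* Local indicability passes to subgroups and to extensions, and free groups have it
by the Nielsen–Schreier theorem. The group of type `A₁` is infinite cyclic. Sending every generator
to `a` retracts the group of type `A₂` onto `⟨a⟩`, and the kernel is free on `b * a⁻¹` and
`a * b * a⁻²`; sending `a, b, c` to `a, b, a` retracts the group of type `A₃` onto the one of type
`A₂`, and the kernel is free on `c * a⁻¹` and its conjugate by `b`. That these kernels are free is
proved by writing down the conjugation action on a free group of rank two, forming the semidirect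
product, and exhibiting a left inverse of the resulting homomorphism from the Artin group
(`CoxeterMatrix.artinTwoEmbed_injective`, `CoxeterMatrix.artinThreeEmbed_injective`).

*Four or more generators.* The subgroup generated by `u = b * a⁻¹`, `v = a * b * a⁻²`,
`x = c * a⁻¹` and `y = d * a⁻¹` is finitely generated and nontrivial. Its generators satisfy the
relations of Gorin and Lin
`v x v⁻¹ = x⁻¹ u x u⁻¹`, `x y x = y x y`, `u y = y v`, `v y = y u⁻¹ v`,
which force every homomorphism to an abelian group to kill `x`, `y`, `u` and `v` in turn
(`GorinLin.hom_eq_one`).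
-/

/-! ### Identities between braids -/

section Braid

variable {G : Type*} [Group G] {a b c : G}

theorem inv_mul_mul_of_braid (hab : a * b * a = b * a * b) : b⁻¹ * a * b = a * b * a⁻¹ := by
  rw [eq_mul_inv_iff_mul_eq, mul_assoc, mul_assoc, inv_mul_eq_iff_eq_mul, ← mul_assoc, hab,
    ← mul_assoc]

/-- A common factor commuting with `a` and `b` may be inserted into the braid relation. -/
theorem mul_braid_of_commute (hab : a * b * a = b * a * b) (ha : Commute c a)
    (hb : Commute c b) :
    a * c * (b * c) * (a * c) = b * c * (a * c) * (b * c) := by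
  rw [hb.mul_mul_mul_comm, (ha.mul_left ha).mul_mul_mul_comm, hab, ha.mul_mul_mul_comm,
    (hb.mul_left hb).mul_mul_mul_comm]

/-- The conjugate by `a` of `b * x * b⁻¹`, where `x = c * a⁻¹`. -/
theorem conj_conj_of_braid (hab : a * b * a = b * a * b) (hbc : b * c * b = c * b * c) :
    a * (b * (c * a⁻¹) * b⁻¹) * a⁻¹ = (c * a⁻¹)⁻¹ * (b * (c * a⁻¹) * b⁻¹) := by
  calc a * (b * (c * a⁻¹) * b⁻¹) * a⁻¹ = a * b * c * (a * b * a)⁻¹ := by group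
    _ = a * (b * c * b⁻¹) * (a⁻¹ * b⁻¹) := by rw [hab]; group
    _ = (c * a⁻¹)⁻¹ * (b * (c * a⁻¹) * b⁻¹) := by rw [← inv_mul_mul_of_braid hbc]; group

/-- The conjugate by `b` of `w = b * x * b⁻¹`, where `x = c * a⁻¹`, is `w * x⁻¹ * w`. -/
theorem conj_conj_self_of_braid (hab : a * b * a = b * a * b) (hbc : b * c * b = c * b * c)
    (hac : a * c = c * a) :
    b * (b * (c * a⁻¹) * b⁻¹) * b⁻¹ =
      b * (c * a⁻¹) * b⁻¹ * (c * a⁻¹)⁻¹ * (b * (c * a⁻¹) * b⁻¹) := by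
  have hac' : a⁻¹ * c = c * a⁻¹ := (Commute.inv_left hac : Commute a⁻¹ c)
  symm
  calc b * (c * a⁻¹) * b⁻¹ * (c * a⁻¹)⁻¹ * (b * (c * a⁻¹) * b⁻¹)
      = b * c * (a⁻¹ * b * a)⁻¹ * (c⁻¹ * b * c) * a⁻¹ * b⁻¹ := by group
    _ = b * c * b * (a⁻¹ * c) * (b * a * b)⁻¹ := by
      rw [inv_mul_mul_of_braid hab.symm, inv_mul_mul_of_braid hbc]; group
    _ = b * (c * b * c) * (a * b * a)⁻¹ * b⁻¹ := by rw [hac']; group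
    _ = b * (b * (c * a⁻¹) * b⁻¹) * b⁻¹ := by rw [← hbc, hab]; group

end Braid

/-! ### Closure properties of local indicability -/

/-- If `H` has nontrivial image in `Q`, a homomorphism on that image can be pulled back; otherwise
`H` lies in the kernel. -/
theorem IsLocallyIndicable.of_ker {G Q : Type*} [Group G] [Group Q] (f : G →* Q)
    (hQ : IsLocallyIndicable Q) (hK : ∀ H : Subgroup G, H ≤ f.ker → H.FG → H ≠ ⊥ → IsIndicable H) :
    IsLocallyIndicable G := by
  intro H hfg hne
  by_cases hle : H ≤ f.ker
  · exact hK H hle hfg hne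
  · have hmap : H.map f ≠ ⊥ := fun h => hle ((Subgroup.map_eq_bot_iff H).1 h)
    obtain ⟨g, hg⟩ := hQ (H.map f) (by
      rw [← Group.fg_iff_subgroup_fg] at hfg ⊢
      exact Group.fg_of_surjective (f.subgroupMap_surjective H)) hmap
    refine ⟨g.comp (f.subgroupMap H), fun h => hg ?_⟩
    rwa [← MonoidHom.cancel_right (f.subgroupMap_surjective H), MonoidHom.one_comp]

theorem IsLocallyIndicable.of_injective {G Q : Type*} [Group G] [Group Q] (f : G →* Q)
    (hf : Function.Injective f) (hQ : IsLocallyIndicable Q) : IsLocallyIndicable G := by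
  refine .of_ker f hQ fun H hle _ hne => absurd ?_ hne
  rwa [(MonoidHom.ker_eq_bot_iff f).2 hf, le_bot_iff] at hle

theorem IsLocallyIndicable.semidirectProduct {N Q : Type*} [Group N] [Group Q] (φ : Q →* MulAut N)
    (hN : IsLocallyIndicable N) (hQ : IsLocallyIndicable Q) : IsLocallyIndicable (N ⋊[φ] Q) := by
  refine .of_ker SemidirectProduct.rightHom hQ fun H hle hfg hne => ?_
  rw [← SemidirectProduct.range_inl_eq_ker_rightHom] at hle
  have hH : (H.comap SemidirectProduct.inl).map SemidirectProduct.inl = H :=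
    Subgroup.map_comap_eq_self hle
  -- `inl` identifies the preimage of `H` in `N` with `H`.
  let e : H.comap (SemidirectProduct.inl (φ := φ)) ≃* H :=
    ((H.comap SemidirectProduct.inl).equivMapOfInjective SemidirectProduct.inl
      SemidirectProduct.inl_injective).trans (MulEquiv.subgroupCongr hH)
  have hfg' : (H.comap (SemidirectProduct.inl (φ := φ))).FG := by
    rw [← Group.fg_iff_subgroup_fg] at hfg ⊢
    exact Group.fg_of_surjective (f := e.symm.toMonoidHom) e.symm.surjective
  have hne' : H.comap (SemidirectProduct.inl (φ := φ)) ≠ ⊥ := fun h => hne <| by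
    rw [← hH, h, Subgroup.map_bot]
  obtain ⟨g, hg⟩ := hN _ hfg' hne'
  refine ⟨g.comp e.symm.toMonoidHom, fun h => hg ?_⟩
  rwa [← MonoidHom.cancel_right (f := e.symm.toMonoidHom) e.symm.surjective, MonoidHom.one_comp]

theorem FreeGroup.isLocallyIndicable (α : Type*) : IsLocallyIndicable (FreeGroup α) := by
  intro H _ hne
  -- `H` is free by Nielsen–Schreier; send all elements of a basis to `1 : ℤ`.
  refine ⟨IsFreeGroup.lift fun _ => Multiplicative.ofAdd 1, fun h => hne ?_⟩
  have hempty : IsEmpty (IsFreeGroup.Generators H) := ⟨fun i => by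
    have hi := IsFreeGroup.lift_of (fun _ => Multiplicative.ofAdd (1 : ℤ)) i
    rw [h, MonoidHom.one_apply] at hi
    exact absurd (congrArg Multiplicative.toAdd hi) (by simp)⟩
  have hsub : Subsingleton H := (IsFreeGroup.toFreeGroup H).injective.subsingleton
  exact Subgroup.eq_bot_of_subsingleton H

/-- The compatibility condition of `SemidirectProduct.lift` may be checked on generators of the
acting group. -/
theorem SemidirectProduct.lift_condition_of_closure {N G H : Type*} [Group N] [Group G] [Group H]
    {φ : G →* MulAut N} (fn : N →* H) (fg : G →* H) {S : Set G} (hS : Subgroup.closure S = ⊤)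
    (h : ∀ g ∈ S, fn.comp (φ g).toMonoidHom = (MulAut.conj (fg g)).toMonoidHom.comp fn) (g : G) :
    fn.comp (φ g).toMonoidHom = (MulAut.conj (fg g)).toMonoidHom.comp fn := by
  have key (g : G) : fn.comp (φ g).toMonoidHom = (MulAut.conj (fg g)).toMonoidHom.comp fn ↔
      ∀ n, fn (φ g n) = fg g * fn n * (fg g)⁻¹ := by
    simp [MonoidHom.ext_iff]
  have hg : g ∈ Subgroup.closure S := hS ▸ Subgroup.mem_top g
  simp only [key] at h ⊢
  induction hg using Subgroup.closure_induction with
  | mem g hg => exact h g hg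
  | one => simp
  | mul g k _ _ hg hk => intro n; simp [hg, hk, mul_assoc]
  | inv g _ hg =>
    intro n
    have := hg (φ g⁻¹ n)
    rw [← MulAut.mul_apply, ← map_mul, mul_inv_cancel, map_one, MulAut.one_apply] at this
    rw [this, map_inv fg]
    group

/-! ### Artin groups of type `A` -/

namespace CoxeterMatrix

/-- The `i`-th standard generator of the Artin group of type `Aₙ`, counted from zero. -/
abbrev artinGen {n : ℕ} (i : Fin n) : (CoxeterMatrix.A n).ArtinGroup := PresentedGroup.of i

theorem A_apply_of_succ {n : ℕ} {i j : Fin n} (h : (i : ℕ) + 1 = j) :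
    CoxeterMatrix.A n i j = 3 := by
  have hij : i ≠ j := by rintro rfl; omega
  simp [CoxeterMatrix.A, hij, h]

theorem A_apply_of_add_two_le {n : ℕ} {i j : Fin n} (h : (i : ℕ) + 2 ≤ j) :
    CoxeterMatrix.A n i j = 2 := by
  have hij : i ≠ j := by rintro rfl; omega
  have hadj : ¬ ((j : ℕ) + 1 = i ∨ (i : ℕ) + 1 = j) := by omega
  simp [CoxeterMatrix.A, hij, hadj]

theorem map_altProd {G H : Type*} [Monoid G] [Monoid H] (f : G →* H) (a b : G) (q : ℕ) :
    f (altProd a b q) = altProd (f a) (f b) q := by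
  induction q generalizing a b with
  | zero => exact map_one f
  | succ q ih => simp [altProd, ih]

theorem altProd_artinGen {n : ℕ} (i j : Fin n) (h : CoxeterMatrix.A n i j ≠ 0) :
    altProd (artinGen i) (artinGen j) (CoxeterMatrix.A n i j) =
      altProd (artinGen j) (artinGen i) (CoxeterMatrix.A n i j) := by
  have hr := PresentedGroup.one_of_mem
    (show _ ∈ (CoxeterMatrix.A n).artinRelators from ⟨i, j, h, rfl⟩)
  rwa [map_mul, map_inv, mul_inv_eq_one, map_altProd, map_altProd] at hr

theorem artinGen_braid {n : ℕ} (i j : Fin n) (h : (i : ℕ) + 1 = j) :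
    artinGen i * artinGen j * artinGen i = artinGen j * artinGen i * artinGen j := by
  have hM := A_apply_of_succ h
  simpa [hM, altProd, mul_assoc] using altProd_artinGen i j (by simp [hM])

theorem artinGen_comm {n : ℕ} (i j : Fin n) (h : (i : ℕ) + 2 ≤ j) :
    artinGen i * artinGen j = artinGen j * artinGen i := by
  have hM := A_apply_of_add_two_le h
  simpa [hM, altProd] using altProd_artinGen i j (by simp [hM])

/-- The universal property of the Artin group of type `Aₙ`: a family satisfying the braid and
commutation relations extends to a homomorphism. -/
def artinLift {n : ℕ} {G : Type*} [Group G] (f : Fin n → G)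
    (hb : ∀ i j : Fin n, (i : ℕ) + 1 = j → f i * f j * f i = f j * f i * f j)
    (hc : ∀ i j : Fin n, (i : ℕ) + 2 ≤ j → f i * f j = f j * f i) :
    (CoxeterMatrix.A n).ArtinGroup →* G :=
  PresentedGroup.toGroup (f := f) <| by
    rintro _ ⟨i, j, -, rfl⟩
    rw [map_mul, map_inv, mul_inv_eq_one, map_altProd, map_altProd, FreeGroup.lift_apply_of,
      FreeGroup.lift_apply_of]
    have key (i j : Fin n) (h : (i : ℕ) < j) : altProd (f i) (f j) (CoxeterMatrix.A n i j) =
        altProd (f j) (f i) (CoxeterMatrix.A n i j) := by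
      rcases Nat.eq_or_lt_of_le h with h' | h'
      · simpa [A_apply_of_succ h', altProd, mul_assoc] using hb i j h'
      · simpa [A_apply_of_add_two_le h', altProd] using hc i j h'
    rcases lt_trichotomy (i : ℕ) j with h | h | h
    · exact key i j h
    · rw [Fin.ext h]
    · rw [(CoxeterMatrix.A n).symmetric i j]
      exact (key j i h).symm

@[simp]
theorem artinLift_gen {n : ℕ} {G : Type*} [Group G] (f : Fin n → G) (hb) (hc) (i : Fin n) :
    artinLift f hb hc (artinGen i) = f i :=
  PresentedGroup.toGroup.of _

/-! ### Free kernels: types `A₁`, `A₂` and `A₃` -/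

theorem isLocallyIndicable_artinOne : IsLocallyIndicable (CoxeterMatrix.A 1).ArtinGroup := by
  let f : (CoxeterMatrix.A 1).ArtinGroup →* FreeGroup (Fin 1) :=
    artinLift FreeGroup.of (by intro i j h; omega) (by intro i j h; omega)
  refine .of_injective f (Function.LeftInverse.injective (g := PresentedGroup.mk _) fun g => ?_)
    (FreeGroup.isLocallyIndicable _)
  refine DFunLike.congr_fun (f := (PresentedGroup.mk _).comp f) (g := MonoidHom.id _) ?_ g
  refine PresentedGroup.ext fun i => ?_
  simp only [MonoidHom.comp_apply, MonoidHom.id_apply, f]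
  rw [artinLift_gen]
  rfl

/-- Conjugation by `a` on the free group on `x = b * a⁻¹` and `w = a * b * a⁻²`
(the letters `0` and `1`): `x ↦ w`, `w ↦ x⁻¹ * w`. -/
def artinTwoAut : MulAut (FreeGroup (Fin 2)) :=
  MonoidHom.toMulEquiv
    (FreeGroup.lift ![.of 1, (.of 0)⁻¹ * .of 1])
    (FreeGroup.lift ![.of 0 * (.of 1)⁻¹, .of 0])
    (by ext i; fin_cases i <;> simp)
    (by ext i; fin_cases i <;> simp)

/-- The action of the Artin group of type `A₁` by powers of `artinTwoAut`. -/
def artinTwoAction : (CoxeterMatrix.A 1).ArtinGroup →* MulAut (FreeGroup (Fin 2)) :=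
  artinLift ![artinTwoAut] (by intro i j h; omega) (by intro i j h; omega)

@[simp]
theorem artinTwoAction_gen (g : FreeGroup (Fin 2)) : artinTwoAction (artinGen 0) g =
    FreeGroup.lift ![.of 1, (.of 0)⁻¹ * .of 1] g := by
  simp [artinTwoAction, artinTwoAut]

/-- The homomorphism `a ↦ a`, `b ↦ (b * a⁻¹) * a`. -/
def artinTwoEmbed :
    (CoxeterMatrix.A 2).ArtinGroup →* FreeGroup (Fin 2) ⋊[artinTwoAction]
      (CoxeterMatrix.A 1).ArtinGroup :=
  artinLift ![⟨1, artinGen 0⟩, ⟨.of 0, artinGen 0⟩]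
    (by
      intro i j h
      obtain ⟨rfl, rfl⟩ : i = 0 ∧ j = 1 := by omega
      ext <;> simp [mul_assoc])
    (by intro i j h; omega)

/-- The left inverse reads the letters as the words they stand for and the generators of the acting
group as generators; it is well defined because conjugation acts on those words as prescribed. -/
theorem artinTwoEmbed_injective : Function.Injective artinTwoEmbed := by
  let a : (CoxeterMatrix.A 2).ArtinGroup := artinGen 0
  let b : (CoxeterMatrix.A 2).ArtinGroup := artinGen 1
  have hab : a * b * a = b * a * b := artinGen_braid 0 1 rfl
  let F : FreeGroup (Fin 2) →* (CoxeterMatrix.A 2).ArtinGroup :=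
    FreeGroup.lift ![b * a⁻¹, a * b * a⁻¹ * a⁻¹]
  let P : (CoxeterMatrix.A 1).ArtinGroup →* (CoxeterMatrix.A 2).ArtinGroup :=
    artinLift ![a] (by intro i j h; omega) (by intro i j h; omega)
  have hFP := SemidirectProduct.lift_condition_of_closure (φ := artinTwoAction) F P
    (PresentedGroup.closure_range_of _) (by
      rintro _ ⟨i, rfl⟩
      obtain rfl : i = 0 := Subsingleton.elim _ _
      have hP : P (artinGen 0) = a := artinLift_gen _ _ _ 0
      ext j
      fin_cases j
      · simp [F, hP, mul_assoc]
      · simpa [F, hP, mul_assoc] using congrArg (· * a⁻¹ * a⁻¹) (inv_mul_mul_of_braid hab))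
  refine Function.LeftInverse.injective (g := SemidirectProduct.lift F P hFP) fun g => ?_
  refine DFunLike.congr_fun (f := (SemidirectProduct.lift F P hFP).comp artinTwoEmbed)
    (g := MonoidHom.id _) ?_ g
  refine PresentedGroup.ext fun i => ?_
  simp only [MonoidHom.comp_apply, MonoidHom.id_apply, artinTwoEmbed]
  rw [artinLift_gen]
  fin_cases i
  · simp [SemidirectProduct.lift, P, a]
  · simp [SemidirectProduct.lift, P, F, a, b]

theorem isLocallyIndicable_artinTwo : IsLocallyIndicable (CoxeterMatrix.A 2).ArtinGroup :=
  .of_injective _ artinTwoEmbed_injective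
    (.semidirectProduct _ (FreeGroup.isLocallyIndicable _) isLocallyIndicable_artinOne)

/-- Conjugation by `a` on the free group on `x = c * a⁻¹` and `w = b * x * b⁻¹` (the letters `0`
and `1`): `x ↦ x`, `w ↦ x⁻¹ * w`. -/
def artinThreeAutA : MulAut (FreeGroup (Fin 2)) :=
  MonoidHom.toMulEquiv
    (FreeGroup.lift ![.of 0, (.of 0)⁻¹ * .of 1])
    (FreeGroup.lift ![.of 0, .of 0 * .of 1])
    (by ext i; fin_cases i <;> simp)
    (by ext i; fin_cases i <;> simp)

/-- Conjugation by `b` on the free group on `x = c * a⁻¹` and `w = b * x * b⁻¹` (the letters `0`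
and `1`): `x ↦ w`, `w ↦ w * x⁻¹ * w`. -/
def artinThreeAutB : MulAut (FreeGroup (Fin 2)) :=
  MonoidHom.toMulEquiv
    (FreeGroup.lift ![.of 1, .of 1 * (.of 0)⁻¹ * .of 1])
    (FreeGroup.lift ![.of 0 * (.of 1)⁻¹ * .of 0, .of 0])
    (by ext i; fin_cases i <;> simp)
    (by ext i; fin_cases i <;> simp)

/-- The action of the Artin group of type `A₂` with `a`, `b` acting by `artinThreeAutA`,
`artinThreeAutB`. -/
def artinThreeAction : (CoxeterMatrix.A 2).ArtinGroup →* MulAut (FreeGroup (Fin 2)) :=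
  artinLift ![artinThreeAutA, artinThreeAutB]
    (by
      intro i j h
      obtain ⟨rfl, rfl⟩ : i = 0 ∧ j = 1 := by omega
      refine MulEquiv.toMonoidHom_injective (FreeGroup.ext_hom _ _ fun k => ?_)
      fin_cases k <;> simp [artinThreeAutA, artinThreeAutB, mul_assoc])
    (by intro i j h; omega)

@[simp]
theorem artinThreeAction_gen_zero (g : FreeGroup (Fin 2)) : artinThreeAction (artinGen 0) g =
    FreeGroup.lift ![.of 0, (.of 0)⁻¹ * .of 1] g := by
  simp [artinThreeAction, artinThreeAutA]

@[simp]
theorem artinThreeAction_gen_one (g : FreeGroup (Fin 2)) : artinThreeAction (artinGen 1) g =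
    FreeGroup.lift ![.of 1, .of 1 * (.of 0)⁻¹ * .of 1] g := by
  simp [artinThreeAction, artinThreeAutB]

/-- The homomorphism `a ↦ a`, `b ↦ b`, `c ↦ (c * a⁻¹) * a`. -/
def artinThreeEmbed :
    (CoxeterMatrix.A 3).ArtinGroup →* FreeGroup (Fin 2) ⋊[artinThreeAction]
      (CoxeterMatrix.A 2).ArtinGroup :=
  artinLift ![⟨1, artinGen 0⟩, ⟨1, artinGen 1⟩, ⟨.of 0, artinGen 0⟩]
    (by
      intro i j h
      have hab := artinGen_braid (0 : Fin 2) 1 rfl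
      obtain ⟨rfl, rfl⟩ | ⟨rfl, rfl⟩ : i = 0 ∧ j = 1 ∨ i = 1 ∧ j = 2 := by omega
      · ext
        · simp
        · simpa using hab
      · ext
        · simp
        · simpa using hab.symm)
    (by
      intro i j h
      obtain ⟨rfl, rfl⟩ : i = 0 ∧ j = 2 := by omega
      ext <;> simp)

/-- The left inverse reads the letters as the words they stand for and the generators of the acting
group as generators; it is well defined because conjugation acts on those words as prescribed. -/
theorem artinThreeEmbed_injective : Function.Injective artinThreeEmbed := by
  let a : (CoxeterMatrix.A 3).ArtinGroup := artinGen 0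
  let b : (CoxeterMatrix.A 3).ArtinGroup := artinGen 1
  let c : (CoxeterMatrix.A 3).ArtinGroup := artinGen 2
  have hab : a * b * a = b * a * b := artinGen_braid 0 1 rfl
  have hbc : b * c * b = c * b * c := artinGen_braid 1 2 rfl
  have hac : a * c = c * a := artinGen_comm 0 2 le_rfl
  let F : FreeGroup (Fin 2) →* (CoxeterMatrix.A 3).ArtinGroup :=
    FreeGroup.lift ![c * a⁻¹, b * (c * a⁻¹) * b⁻¹]
  let P : (CoxeterMatrix.A 2).ArtinGroup →* (CoxeterMatrix.A 3).ArtinGroup :=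
    artinLift ![a, b]
      (by
        intro i j h
        obtain ⟨rfl, rfl⟩ : i = 0 ∧ j = 1 := by omega
        exact hab)
      (by intro i j h; omega)
  have hFP := SemidirectProduct.lift_condition_of_closure (φ := artinThreeAction) F P
    (PresentedGroup.closure_range_of _) (by
      rintro _ ⟨i, rfl⟩
      have hP (i : Fin 2) : P (artinGen i) = ![a, b] i := artinLift_gen _ _ _ i
      ext j
      fin_cases i <;> fin_cases j <;>
        simp [F, hP]
      · rw [← mul_assoc, hac, mul_inv_cancel_right]
      · simpa using (conj_conj_of_braid hab hbc).symm
      · simpa using (conj_conj_self_of_braid hab hbc hac).symm)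
  refine Function.LeftInverse.injective (g := SemidirectProduct.lift F P hFP) fun g => ?_
  refine DFunLike.congr_fun (f := (SemidirectProduct.lift F P hFP).comp artinThreeEmbed)
    (g := MonoidHom.id _) ?_ g
  refine PresentedGroup.ext fun i => ?_
  simp only [MonoidHom.comp_apply, MonoidHom.id_apply, artinThreeEmbed]
  rw [artinLift_gen]
  fin_cases i
  · simp [SemidirectProduct.lift, P, a]
  · simp [SemidirectProduct.lift, P, b]
  · simp [SemidirectProduct.lift, P, F, a, c]

theorem isLocallyIndicable_artinThree : IsLocallyIndicable (CoxeterMatrix.A 3).ArtinGroup :=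
  .of_injective _ artinThreeEmbed_injective
    (.semidirectProduct _ (FreeGroup.isLocallyIndicable _) isLocallyIndicable_artinTwo)

end CoxeterMatrix

/-! ### A finitely generated subgroup without homomorphisms to `ℤ` -/

namespace GorinLin

/-- Under the Gorin–Lin relations every homomorphism to an abelian group is trivial on the four
elements: the relations give in turn `f x = 1`, `f y = f x`, `f u = 1` and `f v = f u`. -/
theorem hom_eq_one {H A : Type*} [Group H] [CommGroup A] (f : H →* A) {u v x y : H}
    (hx : v * x * v⁻¹ = x⁻¹ * u * x * u⁻¹) (hxy : x * y * x = y * x * y) (huy : u * y = y * v)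
    (hvy : v * y = y * u⁻¹ * v) : f u = 1 ∧ f v = 1 ∧ f x = 1 ∧ f y = 1 := by
  have hfx : f x = 1 := by simpa using congrArg f hx
  have hfy : f y = 1 := by simpa [hfx] using (congrArg f hxy).symm
  have hfu : f u = 1 := by simpa [hfy] using congrArg f hvy
  have hfv : f v = 1 := by simpa [hfy, hfu] using (congrArg f huy).symm
  exact ⟨hfu, hfv, hfx, hfy⟩

/-- Four elements satisfying the braid relations of type `A₄`, with `a ≠ b`, obstruct local
indicability: the subgroup generated by `b * a⁻¹`, `a * b * a⁻²`, `c * a⁻¹` and `d * a⁻¹` is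
nontrivial, finitely generated and not indicable. -/
theorem not_isLocallyIndicable {G : Type*} [Group G] {a b c d : G}
    (hab : a * b * a = b * a * b) (hbc : b * c * b = c * b * c) (hcd : c * d * c = d * c * d)
    (hac : a * c = c * a) (had : a * d = d * a) (hbd : b * d = d * b) (hne : a ≠ b) :
    ¬ IsLocallyIndicable G := by
  intro h
  let S : Set G := {b * a⁻¹, a * b * a⁻¹ * a⁻¹, c * a⁻¹, d * a⁻¹}
  let u : Subgroup.closure S := ⟨b * a⁻¹, Subgroup.subset_closure (by simp [S])⟩
  let v : Subgroup.closure S := ⟨a * b * a⁻¹ * a⁻¹, Subgroup.subset_closure (by simp [S])⟩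
  let x : Subgroup.closure S := ⟨c * a⁻¹, Subgroup.subset_closure (by simp [S])⟩
  let y : Subgroup.closure S := ⟨d * a⁻¹, Subgroup.subset_closure (by simp [S])⟩
  have hfin : S.Finite := by simp [S]
  have hbot : Subgroup.closure S ≠ ⊥ := fun hbot => hne <| by
    have hu : b * a⁻¹ ∈ (⊥ : Subgroup G) := hbot ▸ u.2
    exact (mul_inv_eq_one.1 (Subgroup.mem_bot.1 hu)).symm
  obtain ⟨f, hf⟩ := h (Subgroup.closure S) ((Subgroup.fg_iff _).2 ⟨S, rfl, hfin⟩) hbot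
  have hac' : a⁻¹ * c = c * a⁻¹ := (Commute.inv_left hac : Commute a⁻¹ c)
  have had' : a⁻¹ * d = d * a⁻¹ := (Commute.inv_left had : Commute a⁻¹ d)
  have hx : a * b * a⁻¹ * a⁻¹ * (c * a⁻¹) * (a * b * a⁻¹ * a⁻¹)⁻¹ =
      (c * a⁻¹)⁻¹ * (b * a⁻¹) * (c * a⁻¹) * (b * a⁻¹)⁻¹ := by
    calc a * b * a⁻¹ * a⁻¹ * (c * a⁻¹) * (a * b * a⁻¹ * a⁻¹)⁻¹
        = a * b * a⁻¹ * (a⁻¹ * c) * a * b⁻¹ * a⁻¹ := by group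
      _ = a * b * a⁻¹ * c * b⁻¹ * a⁻¹ := by rw [hac']; group
      _ = a * b * (a⁻¹ * c) * b⁻¹ * a⁻¹ := by group
      _ = a * (b * (c * a⁻¹) * b⁻¹) * a⁻¹ := by rw [hac']; group
      _ = (c * a⁻¹)⁻¹ * (b * (a⁻¹ * c) * b⁻¹) := by rw [conj_conj_of_braid hab hbc, hac']
      _ = (c * a⁻¹)⁻¹ * (b * a⁻¹) * (c * a⁻¹) * (b * a⁻¹)⁻¹ := by group
  have huy : b * a⁻¹ * (d * a⁻¹) = d * a⁻¹ * (a * b * a⁻¹ * a⁻¹) := by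
    calc b * a⁻¹ * (d * a⁻¹) = b * (a⁻¹ * d) * a⁻¹ := by group
      _ = b * d * a⁻¹ * a⁻¹ := by rw [had']; group
      _ = d * a⁻¹ * (a * b * a⁻¹ * a⁻¹) := by rw [hbd]; group
  have hvy : a * b * a⁻¹ * a⁻¹ * (d * a⁻¹) =
      d * a⁻¹ * (b * a⁻¹)⁻¹ * (a * b * a⁻¹ * a⁻¹) := by
    calc a * b * a⁻¹ * a⁻¹ * (d * a⁻¹) = a * b * a⁻¹ * (a⁻¹ * d) * a⁻¹ := by group
      _ = a * b * a⁻¹ * d * a⁻¹ * a⁻¹ := by rw [had']; group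
      _ = a * b * (a⁻¹ * d) * a⁻¹ * a⁻¹ := by group
      _ = a * (b * d) * a⁻¹ * a⁻¹ * a⁻¹ := by rw [had']; group
      _ = a * d * b * a⁻¹ * a⁻¹ * a⁻¹ := by rw [hbd]; group
      _ = d * (a * b * a⁻¹) * a⁻¹ * a⁻¹ := by rw [had]; group
      _ = d * (b⁻¹ * a * b) * a⁻¹ * a⁻¹ := by rw [inv_mul_mul_of_braid hab]
      _ = d * a⁻¹ * (b * a⁻¹)⁻¹ * (a * b * a⁻¹ * a⁻¹) := by group
  obtain ⟨hu, hv, hx, hy⟩ := hom_eq_one f (u := u) (v := v) (x := x) (y := y)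
    (Subtype.ext hx) (Subtype.ext (mul_braid_of_commute hcd hac' had')) (Subtype.ext huy)
    (Subtype.ext hvy)
  refine hf (MonoidHom.ext fun g => ?_)
  obtain ⟨g, hg⟩ := g
  induction hg using Subgroup.closure_induction with
  | mem g hg =>
    rcases hg with rfl | rfl | rfl | rfl
    exacts [hu, hv, hx, hy]
  | one => exact map_one f
  | mul g k hg hk ihg ihk =>
    have := map_mul f ⟨g, hg⟩ ⟨k, hk⟩
    rwa [ihg, ihk] at this
  | inv g hg ihg =>
    have := map_inv f ⟨g, hg⟩
    rwa [ihg] at this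

end GorinLin

/-- Two adjacent generators map to distinct transpositions in the symmetric group. -/
theorem CoxeterMatrix.artinGen_ne {n : ℕ} {i j : Fin n} (h : (i : ℕ) + 1 = j) :
    artinGen i ≠ artinGen j := by
  let f : (CoxeterMatrix.A n).ArtinGroup →* Equiv.Perm ℕ :=
    artinLift (fun i => Equiv.swap (i : ℕ) (i + 1))
      (by
        intro i j h
        rw [← h, Equiv.swap_mul_swap_mul_swap (by omega) (by omega), Equiv.swap_comm (i : ℕ),
          Equiv.swap_comm ((i : ℕ) + 1) (i + 1 + 1),
          Equiv.swap_mul_swap_mul_swap (by omega) (by omega)]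
        exact Equiv.swap_comm _ _)
      (by
        intro i j h
        ext k
        simp only [Equiv.Perm.mul_apply, Equiv.swap_apply_def]
        split_ifs <;> omega)
  intro hij
  have hf : f (artinGen i) i = f (artinGen j) i := by rw [hij]
  simp only [f, artinLift_gen] at hf
  rw [Equiv.swap_apply_left, Equiv.swap_apply_of_ne_of_ne (by omega) (by omega)] at hf
  omega

theorem mainTheorem2 (n : ℕ) (hn : 1 ≤ n) :
    IsLocallyIndicable (CoxeterMatrix.A n).ArtinGroup ↔ n = 1 ∨ n = 2 ∨ n = 3 := by
  constructor
  · intro h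
    by_contra hcon
    have h4 : 4 ≤ n := by omega
    let i (k : ℕ) (hk : k < 4) : Fin n := ⟨k, by omega⟩
    refine GorinLin.not_isLocallyIndicable
      (a := CoxeterMatrix.artinGen (i 0 (by omega))) (b := CoxeterMatrix.artinGen (i 1 (by omega)))
      (c := CoxeterMatrix.artinGen (i 2 (by omega))) (d := CoxeterMatrix.artinGen (i 3 (by omega)))
      (CoxeterMatrix.artinGen_braid _ _ rfl) (CoxeterMatrix.artinGen_braid _ _ rfl)
      (CoxeterMatrix.artinGen_braid _ _ rfl) (CoxeterMatrix.artinGen_comm _ _ (by simp [i]))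
      (CoxeterMatrix.artinGen_comm _ _ (by simp [i])) (CoxeterMatrix.artinGen_comm _ _ (by simp [i]))
      (CoxeterMatrix.artinGen_ne rfl) h
  · rintro (rfl | rfl | rfl)
    exacts [CoxeterMatrix.isLocallyIndicable_artinOne, CoxeterMatrix.isLocallyIndicable_artinTwo,
      CoxeterMatrix.isLocallyIndicable_artinThree]
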